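/- **Theorem.** Let $R=\mathbb{R}[x_1,\dots,x_n]$ and let $R_d$ be the space of polynomials of degree $\le d$. Let $A\subset\mathbb{N}^n$ be finite, let $V\subset R$ be the space spanned by the monomials $\mathbf{x}^\alpha$, $\alpha\in A$, let $\deg V=\max_{\alpha\in A}|\alpha|$ ($0$ if $A=\emptyset$), and let $\mathbf{i}\in V^*$ be a linear form, with moments $\mathbf{i}_\alpha=\langle\mathbf{i}\mid\mathbf{x}^\alpha\rangle$, $\alpha\in A$ (for example $\langle \mathbf{i}\mid v\rangle=I[v]=\int_\Omega w\,v\,d\mathbf{x}$). For $k\in\mathbb{N}$ and $\sigma\in R_{2k}^*$ let $H_\sigma:R_k\to R_k^*$, $H_\sigma(p)(q)=\langle\sigma\mid pq\rangle$, be the truncated Hankel operator; write $H_\sigma\succcurlyeq 0$ if $\langle\sigma\mid p^2\rangle\ge 0$ for all $p\in R_k$, and write $H_\sigma$ also for its matrix $(\langle\sigma\mid\mathbf{x}^{\alpha+\beta}\rangle)_{|\alpha|,|\beta|\le k}$ in the monomial basis. Let $$\mathcal{H}^k(\mathbf{i})=\{H_\sigma\mid \sigma\in R_{2k}^*,\ \langle\sigma\mid\mathbf{x}^\alpha\rangle=\mathbf{i}_\alpha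 \text{ for } \alpha\in A,\ H_\sigma\succcurlyeq 0\},$$ and for $r\in\mathbb{N}$ let $\mathcal{E}^k_r(\mathbf{i})$ be the set of those $H_\sigma\in\mathcal{H}^k(\mathbf{i})$ for which $\sigma=\sum_{j=1}^r\omega_j\mathbf{e}_{\zeta_j}$ on $R_{2k}$ for some $\omega_j>0$ and $\zeta_j\in\mathbb{R}^n$, where $\mathbf{e}_\zeta(f)=f(\zeta)$. Let $s_k=\dim R_k$, let $\mathbf{x}^{(k)}$ be the vector of all monomials of degree $\le k$, and let $P\in\mathbb{R}^{s_k\times s_k}$ be a proper matrix, meaning that the homogeneous component of degree $2k$ of the polynomial $q(\mathbf{x})=(\mathbf{x}^{(k)})^tPP^t\mathbf{x}^{(k)}$ vanishes at no $\mathbf{x}\in\mathbb{R}^n\setminus\{0\}$. Assume that $k\ge\frac{\deg V+1}{2}$, and that $\sigma^*\in R_{2k}^*$ is such that $H_{\sigma^*}$ minimizes $\mathrm{trace}(P^tHP)$ over $H\in\mathcal{H}^k(\mathbf{i})$ and has rank $r\le k$. Then $H_{\sigma^*}\in\mathcal{E}^k_r(\mathbf{i})$. More precisely, there are $\omega_1,\dots,\omega_r>0$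 and pairwise distinct points $\zeta_1,\dots,\zeta_r\in\mathbb{R}^n$ such that $$\sigma^*=\sum_{j=1}^r\omega_j\,\mathbf{e}_{\zeta_j}\ \text{ on } R_{2k},\qquad\text{and}\qquad \langle\mathbf{i}\mid v\rangle=\sum_{j=1}^r\omega_j\,v(\zeta_j)\ \text{ for all } v\in V,$$ that is, an $r$-point cubature formula exact on $V$. -/

import Mathlib

noncomputable section

namespace HankelCubature

open MvPolynomial

/-- `R_d`: the real polynomials in `x_1, …, x_n` of degree at most `d`. -/
abbrev PolyLE (n d : ℕ) : Submodule ℝ (MvPolynomial (Fin n) ℝ) :=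
  restrictTotalDegree (Fin n) ℝ d

/-- The exponents of the monomials of degree at most `k`: the index set of the monomial
basis of `R_k`, of size `s_k`. -/
abbrev Expo (n k : ℕ) : Type := {α : Fin n →₀ ℕ // α.degree ≤ k}

instance expoFinite (n k : ℕ) : Finite (Expo n k) := by
  refine Set.Finite.subset (Set.finite_Iic
    (Finsupp.equivFunOnFinite.symm (fun _ : Fin n => k))) ?_
  intro α hα i
  exact (Finsupp.le_degree i α).trans hα

instance expoFintype (n k : ℕ) : Fintype (Expo n k) := Fintype.ofFinite _

theorem monomial_mem {n d : ℕ} {α : Fin n →₀ ℕ} (h : α.degree ≤ d) :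
    monomial α (1 : ℝ) ∈ PolyLE n d := by
  rw [mem_restrictTotalDegree, totalDegree_monomial _ one_ne_zero]
  exact h

theorem mul_mem {n k : ℕ} (p q : PolyLE n k) :
    (p : MvPolynomial (Fin n) ℝ) * q ∈ PolyLE n (2 * k) := by
  have hp := (mem_restrictTotalDegree _ _ _).1 p.2
  have hq := (mem_restrictTotalDegree _ _ _).1 q.2
  rw [mem_restrictTotalDegree]
  have := totalDegree_mul (p : MvPolynomial (Fin n) ℝ) q
  omega

/-- The monomial `x^α`, as an element of `R_k`. -/
def mono {n k : ℕ} (α : Expo n k) : PolyLE n k := ⟨monomial α.1 1, monomial_mem α.2⟩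

/-- The truncated Hankel operator `H_σ : R_k → R_k^*`, `p ↦ (q ↦ ⟨σ | p q⟩)`, of a linear
form `σ` on `R_{2k}`. -/
def hankel {n k : ℕ} (σ : Module.Dual ℝ (PolyLE n (2 * k))) :
    PolyLE n k →ₗ[ℝ] Module.Dual ℝ (PolyLE n k) :=
  LinearMap.mk₂ ℝ (fun p q => σ ⟨(p : MvPolynomial (Fin n) ℝ) * q, mul_mem p q⟩)
    (fun p p' q => by
      rw [← map_add]; congr 1; ext1; simp [add_mul])
    (fun c p q => by
      rw [← map_smul]; congr 1; ext1; simp)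
    (fun p q q' => by
      rw [← map_add]; congr 1; ext1; simp [mul_add])
    (fun c p q => by
      rw [← map_smul]; congr 1; ext1; simp)

/-- Positive semidefiniteness of the quadratic form `p ↦ H(p, p)`
(a Hankel operator is symmetric by construction). -/
def IsPSD {n k : ℕ} (H : PolyLE n k →ₗ[ℝ] Module.Dual ℝ (PolyLE n k)) : Prop :=
  ∀ p, 0 ≤ H p p

/-- The matrix of `H` in the monomial basis of `R_k`; for `H = H_σ` its entries are
`⟨σ | x^(α+β)⟩`. -/
def toMat {n k : ℕ} (H : PolyLE n k →ₗ[ℝ] Module.Dual ℝ (PolyLE n k)) :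
    Matrix (Expo n k) (Expo n k) ℝ :=
  Matrix.of fun α β => H (mono α) (mono β)

/-- The space `V` spanned by the monomials `x^α`, `α ∈ A`. -/
abbrev monSpan {n : ℕ} (A : Finset (Fin n →₀ ℕ)) : Submodule ℝ (MvPolynomial (Fin n) ℝ) :=
  Submodule.span ℝ ((fun α => monomial α (1 : ℝ)) '' (A : Set (Fin n →₀ ℕ)))

/-- The monomial `x^α`, `α ∈ A`, as an element of `V`. -/
def monV {n : ℕ} {A : Finset (Fin n →₀ ℕ)} {α : Fin n →₀ ℕ} (h : α ∈ A) : monSpan A :=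
  ⟨monomial α 1, Submodule.subset_span ⟨α, h, rfl⟩⟩

/-- `deg V`, the largest degree of an element of `V`. -/
def degV {n : ℕ} (A : Finset (Fin n →₀ ℕ)) : ℕ := A.sup fun α => α.degree

/-- `σ` extends the moments of `i`: `σ_α = i_α` for the `α ∈ A`. (The degree condition only
says that `σ_α` makes sense; it holds for all `α ∈ A` as soon as `deg V ≤ d`.) -/
def ExtendsMoments {n d : ℕ} {A : Finset (Fin n →₀ ℕ)} (i : Module.Dual ℝ (monSpan A))
    (σ : Module.Dual ℝ (PolyLE n d)) : Prop :=
  ∀ (α : Fin n →₀ ℕ) (hA : α ∈ A) (hd : α.degree ≤ d),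
    σ ⟨monomial α 1, monomial_mem hd⟩ = i (monV hA)

/-- The set `ℋ^k(i)` of positive semidefinite truncated Hankel operators of the linear forms
on `R_{2k}` that extend the moments of `i`. -/
def hankelSet {n : ℕ} {A : Finset (Fin n →₀ ℕ)} (i : Module.Dual ℝ (monSpan A)) (k : ℕ) :
    Set (PolyLE n k →ₗ[ℝ] Module.Dual ℝ (PolyLE n k)) :=
  {H | ∃ σ : Module.Dual ℝ (PolyLE n (2 * k)),
    H = hankel σ ∧ ExtendsMoments i σ ∧ IsPSD (hankel σ)}

/-- Evaluation `e_ζ` at `ζ ∈ ℝⁿ`, on polynomials of degree at most `d`. -/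
def evalAt {n : ℕ} (d : ℕ) (ζ : Fin n → ℝ) : Module.Dual ℝ (PolyLE n d) :=
  (aeval ζ : MvPolynomial (Fin n) ℝ →ₐ[ℝ] ℝ).toLinearMap.domRestrict (PolyLE n d)

/-- The set `ℰ^k_r(i)` of the elements `H_σ` of `ℋ^k(i)` with `σ = ∑_{j ≤ r} ω_j e_{ζ_j}`,
`ω_j > 0`, `ζ_j ∈ ℝⁿ`. -/
def cubatureSet {n : ℕ} {A : Finset (Fin n →₀ ℕ)} (i : Module.Dual ℝ (monSpan A))
    (k r : ℕ) : Set (PolyLE n k →ₗ[ℝ] Module.Dual ℝ (PolyLE n k)) :=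
  {H | H ∈ hankelSet i k ∧ ∃ (ω : Fin r → ℝ) (ζ : Fin r → Fin n → ℝ),
    (∀ j, 0 < ω j) ∧ H = hankel (∑ j, ω j • evalAt (2 * k) (ζ j))}

/-- The objective `trace (Pᵗ H P)`. -/
def objective {n k : ℕ} (P : Matrix (Expo n k) (Expo n k) ℝ)
    (H : PolyLE n k →ₗ[ℝ] Module.Dual ℝ (PolyLE n k)) : ℝ :=
  (P.transpose * toMat H * P).trace

/-- `H` is a minimizer of `trace (Pᵗ H P)` over `ℋ^k(i)`. -/
def IsMinimizer {n k : ℕ} {A : Finset (Fin n →₀ ℕ)} (i : Module.Dual ℝ (monSpan A))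
    (P : Matrix (Expo n k) (Expo n k) ℝ)
    (H : PolyLE n k →ₗ[ℝ] Module.Dual ℝ (PolyLE n k)) : Prop :=
  H ∈ hankelSet i k ∧ ∀ H' ∈ hankelSet i k, objective P H ≤ objective P H'

/-- The polynomial `q(x) = (x^(k))ᵗ P Pᵗ x^(k)`, where `x^(k)` is the vector of the monomials
of degree at most `k`. -/
def quadPoly {n k : ℕ} (P : Matrix (Expo n k) (Expo n k) ℝ) : MvPolynomial (Fin n) ℝ :=
  ∑ α : Expo n k, ∑ β : Expo n k,
    C ((P * P.transpose) α β) * (monomial α.1 1 * monomial β.1 1)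

/-- `P` is proper: the component of degree `2k` of `q` has no zero other than the origin. -/
def IsProper {n k : ℕ} (P : Matrix (Expo n k) (Expo n k) ℝ) : Prop :=
  ∀ x : Fin n → ℝ, x ≠ 0 → eval x (homogeneousComponent (2 * k) (quadPoly P)) ≠ 0

end HankelCubature

end

/-! The heart is `exists_atomic_of_finrank_le`: after homogenizing by one variable, a positive
semidefinite Hankel form on forms of degree `k` with rank at most `k` is a nonnegative combination
of evaluations at nonzero points. Write it as a Gram form of a map `φ`, pick a variable `X o`, and
let `F` be the image of the multiples of `X o`. The images of the forms divisible by decreasing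
powers of `X o` form a chain of `k` steps: if every step is strict, the rank bound makes `F` the
whole image; otherwise stationarity propagates to the last step. Either way, elements of `F` have
representatives for which the compressions `φ (X o * p) ↦ P_F (φ (X i * p))` are seen to commute.
They are symmetric, and their joint eigenvalues are the points in the chart `X o = 1`. The part of
`φ` orthogonal to `F` is again Hankel, of no larger rank, and kills the multiples of `X o`; induct
on the variables.

Back on `R_{2k}`, atoms with vanishing extra coordinate lie at infinity and see only the component
of degree `2k`. As `deg V < 2k`, dropping them preserves the moments, and it strictly lowers the
trace because `P` is proper. So a minimizer has none, and polynomials of degree `k` separate enough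
points to make the number of atoms equal the rank. -/

noncomputable section

namespace HankelCubature

open MvPolynomial

/-- Commuting symmetric operators: every vector is a finite sum of pairwise orthogonal joint
eigenvectors, indexed by their tuples of eigenvalues. -/
theorem exists_joint_eigenvector_sum {ι F : Type*} [NormedAddCommGroup F] [InnerProductSpace ℝ F]
    [FiniteDimensional ℝ F] (M : ι → F →ₗ[ℝ] F) (hM : ∀ i, (M i).IsSymmetric)
    (hc : ∀ i j, Commute (M i) (M j)) (e : F) :
    ∃ f : (ι → ℝ) →₀ F, (∀ a i, M i (f a) = a i • f a) ∧
      (∀ a b, a ≠ b → inner ℝ (f a) (f b) = 0) ∧ f.sum (fun _ v => v) = e := by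
  have htop := LinearMap.IsSymmetric.iSup_iInf_eq_top_of_commute hM (fun i j _ => hc i j)
  have he : e ∈ (⊤ : Submodule ℝ F) := trivial
  rw [← htop, Submodule.mem_iSup_iff_exists_finsupp] at he
  obtain ⟨f, hf, hsum⟩ := he
  refine ⟨f, fun a i => ?_, fun a b hab => ?_, hsum⟩
  · exact Module.End.mem_eigenspace_iff.1 ((Submodule.mem_iInf _).1 (hf a) i)
  · exact LinearMap.IsSymmetric.orthogonalFamily_iInf_eigenspaces hM hab ⟨f a, hf a⟩ ⟨f b, hf b⟩

/-! ### Forms and their filtration by powers of a variable -/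

section Homogeneous

variable {ι : Type*}

theorem isHomogeneous_of_X_mul {o : ι} {p : MvPolynomial ι ℝ} {d : ℕ}
    (h : (X o * p).IsHomogeneous (d + 1)) : p.IsHomogeneous d := by
  intro m hm
  have h1 := @h (Finsupp.single o 1 + m) (by rwa [coeff_X_mul])
  rw [map_add, Finsupp.weight_single] at h1
  simp only [Pi.one_apply, smul_eq_mul, mul_one] at h1
  omega

theorem isHomogeneous_of_X_pow_mul {o : ι} (m : ℕ) {p : MvPolynomial ι ℝ} {d : ℕ}
    (h : (X o ^ m * p).IsHomogeneous (d + m)) : p.IsHomogeneous d := by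
  induction m with
  | zero => simpa using h
  | succ m ih =>
    apply ih
    apply isHomogeneous_of_X_mul (o := o)
    rw [← mul_assoc, ← pow_succ']
    exact h

theorem isHomogeneous_X_mul (i : ι) {p : MvPolynomial ι ℝ} {d : ℕ} (h : p.IsHomogeneous d) :
    (X i * p).IsHomogeneous (d + 1) := by
  rw [add_comm]
  exact (isHomogeneous_X ℝ i).mul h

theorem isHomogeneous_X_pow_mul (i : ι) (m : ℕ) {p : MvPolynomial ι ℝ} {d : ℕ}
    (h : p.IsHomogeneous d) : (X i ^ m * p).IsHomogeneous (d + m) := by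
  rw [add_comm]
  exact (isHomogeneous_X_pow i m).mul h

/-- A subspace containing all products of a variable with a form of degree `d` contains all
forms of degree `d + 1`. -/
theorem isHomogeneous_succ_mem {N : Submodule ℝ (MvPolynomial ι ℝ)} {d : ℕ}
    (hN : ∀ i, ∀ p : MvPolynomial ι ℝ, p.IsHomogeneous d → X i * p ∈ N)
    {f : MvPolynomial ι ℝ} (hf : f.IsHomogeneous (d + 1)) : f ∈ N := by
  rw [← support_sum_monomial_coeff f]
  refine N.sum_mem fun m hm => ?_
  have hdeg : m.degree = d + 1 := by
    by_contra h
    exact (mem_support_iff.1 hm) (hf.coeff_eq_zero h)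
  have hm0 : m ≠ 0 := by
    rintro rfl
    simp at hdeg
  obtain ⟨i, hi⟩ := Finsupp.ne_iff.1 hm0
  have hi' : Finsupp.single i 1 ≤ m := by
    rw [Finsupp.single_le_iff]
    exact Nat.one_le_iff_ne_zero.2 hi
  have hsplit : Finsupp.single i 1 + (m - Finsupp.single i 1) = m := add_tsub_cancel_of_le hi'
  have hmono : monomial m (coeff m f) = X i * monomial (m - Finsupp.single i 1) (coeff m f) := by
    rw [X, monomial_mul, hsplit, one_mul]
  rw [hmono]
  refine hN i _ (isHomogeneous_monomial _ ?_)
  have := congrArg Finsupp.degree hsplit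
  rw [map_add, Finsupp.degree_single] at this
  omega

/-- The forms of degree `K + 1` divisible by `X o ^ (K + 2 - j)`. -/
def divisibleForms (o : ι) (K j : ℕ) : Submodule ℝ (MvPolynomial ι ℝ) where
  -- At `j = 0` the exponent exceeds the degree, so only `0` qualifies; at `j = K + 1` these are all
  -- multiples of `X o`.
  carrier := {f | f.IsHomogeneous (K + 1) ∧ X o ^ (K + 2 - j) ∣ f}
  add_mem' := fun hf hg => ⟨hf.1.add hg.1, dvd_add hf.2 hg.2⟩
  zero_mem' := ⟨isHomogeneous_zero _ _ _, dvd_zero _⟩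
  smul_mem' := fun c f hf => by
    rw [smul_eq_C_mul]
    exact ⟨hf.1.C_mul c, hf.2.mul_left _⟩

theorem mem_divisibleForms {o : ι} {K j : ℕ} {f : MvPolynomial ι ℝ} :
    f ∈ divisibleForms o K j ↔ f.IsHomogeneous (K + 1) ∧ X o ^ (K + 2 - j) ∣ f := Iff.rfl

theorem divisibleForms_mono (o : ι) (K : ℕ) {j l : ℕ} (h : j ≤ l) :
    divisibleForms o K j ≤ divisibleForms o K l :=
  fun _ hf => ⟨hf.1, (pow_dvd_pow _ (by omega)).trans hf.2⟩

theorem mem_divisibleForms_succ {o : ι} {K : ℕ} {f : MvPolynomial ι ℝ} :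
    f ∈ divisibleForms o K (K + 1) ↔ ∃ p : MvPolynomial ι ℝ, p.IsHomogeneous K ∧ X o * p = f := by
  rw [mem_divisibleForms, show K + 2 - (K + 1) = 1 by omega, pow_one]
  constructor
  · rintro ⟨hf, p, rfl⟩
    exact ⟨p, isHomogeneous_of_X_mul hf, rfl⟩
  · rintro ⟨p, hp, rfl⟩
    exact ⟨isHomogeneous_X_mul o hp, dvd_mul_right _ _⟩

/-! ### Hankel Gram forms and the chain of images -/

variable {E : Type*} [NormedAddCommGroup E] [InnerProductSpace ℝ E]

/-- The Gram form `(p, q) ↦ ⟪φ p, φ q⟫` on forms of degree `d` is of Hankel type: it only depends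
on the product `p * q`. -/
def IsHankelGram (d : ℕ) (φ : MvPolynomial ι ℝ →ₗ[ℝ] E) : Prop :=
  ∀ p q p' q' : MvPolynomial ι ℝ, p.IsHomogeneous d → q.IsHomogeneous d → p'.IsHomogeneous d →
    q'.IsHomogeneous d → p * q = p' * q' → inner ℝ (φ p) (φ q) = inner ℝ (φ p') (φ q')

/-- Stationarity of the chain of images of the forms divisible by powers of `X o`
propagates one step. -/
theorem map_divisibleForms_le_succ {K : ℕ} {φ : MvPolynomial ι ℝ →ₗ[ℝ] E}
    (hφ : IsHankelGram (K + 1) φ) (o : ι) {j : ℕ} (hj : j + 1 ≤ K)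
    (h : (divisibleForms o K (j + 1)).map φ ≤ (divisibleForms o K j).map φ) :
    (divisibleForms o K (j + 2)).map φ ≤ (divisibleForms o K (j + 1)).map φ := by
  obtain ⟨t, rfl⟩ : ∃ t, K = j + 1 + t := ⟨K - (j + 1), by omega⟩
  rintro _ ⟨f, hf, rfl⟩
  obtain ⟨hf, g, rfl⟩ := hf
  rw [show j + 1 + t + 2 - (j + 2) = t + 1 by omega] at hf ⊢
  have hg : g.IsHomogeneous (j + 1) := by
    apply isHomogeneous_of_X_pow_mul (o := o) (t + 1)
    convert hf using 1
    omega
  -- By linearity it suffices to take `g = X i * p`.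
  refine isHomogeneous_succ_mem
    (N := ((divisibleForms o (j + 1 + t) (j + 1)).map φ).comap
      (φ ∘ₗ LinearMap.mulLeft ℝ (X o ^ (t + 1)))) (fun i p hp => ?_) hg
  simp only [Submodule.mem_comap, LinearMap.comp_apply, LinearMap.mulLeft_apply]
  have hmem : X o * (X o ^ (t + 1) * p) ∈ divisibleForms o (j + 1 + t) (j + 1) := by
    refine ⟨?_, ?_⟩
    · have := isHomogeneous_X_mul o (isHomogeneous_X_pow_mul o (t + 1) hp)
      convert this using 1
      omega
    · rw [← mul_assoc, ← pow_succ', show j + 1 + t + 2 - (j + 1) = t + 1 + 1 by omega]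
      exact dvd_mul_right _ _
  obtain ⟨b, ⟨hb, c, rfl⟩, hbc⟩ := h ⟨_, hmem, rfl⟩
  rw [show j + 1 + t + 2 - j = t + 3 by omega] at hb hbc
  have hc : (X o ^ (t + 1) * c).IsHomogeneous (j + t) := by
    apply isHomogeneous_of_X_pow_mul (o := o) 2
    rw [← mul_assoc, ← pow_add]
    convert hb using 1
    · congr 2; omega
    · omega
  have hpt : (X o ^ t * p).IsHomogeneous (j + t) := isHomogeneous_X_pow_mul o t hp
  -- The hypothesis says exactly that `φ` kills `X o ^ 2 * κ`. One factor `X o` is now to be traded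
  -- for `X i`.
  set κ := X o ^ t * p - X o ^ (t + 1) * c with hκ
  have hκh : κ.IsHomogeneous (j + t) := hpt.sub hc
  have h0 : φ (X o * (X o * κ)) = 0 := by
    have : X o * (X o * κ) = X o * (X o ^ (t + 1) * p) - X o ^ (t + 3) * c := by
      rw [hκ]; ring
    rw [this, map_sub, hbc, sub_self]
  have hd : ∀ i l : ι, (X i * (X l * κ)).IsHomogeneous (j + 1 + t + 1) := fun i l => by
    convert isHomogeneous_X_mul i (isHomogeneous_X_mul l hκh) using 1
    omega
  -- The squared norm regroups as the inner product of `φ (X o ^ 2 * κ)` with `φ (X i ^ 2 * κ)`.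
  have h1 : φ (X i * (X o * κ)) = 0 := by
    rw [← inner_self_eq_zero (𝕜 := ℝ),
      hφ _ _ (X o * (X o * κ)) (X i * (X i * κ)) (hd _ _) (hd _ _) (hd _ _) (hd _ _) (by ring),
      h0, inner_zero_left]
  have h2 : X o ^ (t + 1) * (X i * p) = X i * (X o * κ) + X o ^ (t + 2) * (X i * c) := by
    rw [hκ]; ring
  rw [h2, map_add, h1, zero_add]
  refine ⟨_, ⟨?_, ?_⟩, rfl⟩
  · have := isHomogeneous_X_mul o (isHomogeneous_X_mul i hc)
    convert this using 1
    · ring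
    · omega
  · rw [show j + 1 + t + 2 - (j + 1) = t + 2 by omega]
    exact dvd_mul_right _ _

/-- If the rank is at most the degree, then every element of the image of the multiples of `X o`
is represented by `X o * p` such that the image also contains the classes of all `X i * p`. -/
theorem exists_repr_of_finrank_le [FiniteDimensional ℝ E] {K : ℕ} {φ : MvPolynomial ι ℝ →ₗ[ℝ] E}
    (hφ : IsHankelGram (K + 1) φ) (o : ι)
    (hrank : Module.finrank ℝ ((homogeneousSubmodule ι ℝ (K + 1)).map φ) ≤ K + 1)
    {w : E} (hw : w ∈ (divisibleForms o K (K + 1)).map φ) :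
    ∃ p : MvPolynomial ι ℝ, p.IsHomogeneous K ∧ φ (X o * p) = w ∧
      ∀ i, φ (X i * p) ∈ (divisibleForms o K (K + 1)).map φ := by
  by_cases h : (divisibleForms o K (K + 1)).map φ ≤ (divisibleForms o K K).map φ
  -- Stationary last step: a representative divisible by `X o ^ 2` keeps a factor `X o` when the
  -- other is replaced by `X i`.
  · obtain ⟨f, ⟨hf, g, rfl⟩, rfl⟩ := h hw
    rw [show K + 2 - K = 2 by omega] at hf ⊢
    have hg : (X o * g).IsHomogeneous K := by
      apply isHomogeneous_of_X_mul (o := o)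
      rw [← mul_assoc, ← pow_two]
      exact hf
    refine ⟨X o * g, hg, by rw [← mul_assoc, ← pow_two], fun i => ?_⟩
    refine ⟨_, ⟨isHomogeneous_X_mul i hg, ?_⟩, rfl⟩
    rw [show K + 2 - (K + 1) = 1 by omega, pow_one]
    exact ⟨X i * g, by ring⟩
  -- Otherwise no step is stationary, so the dimension reaches `K + 1` and the multiples of `X o`
  -- already fill the image.
  · have hstep : ∀ j m, j + m ≤ K →
        (divisibleForms o K (j + 1)).map φ ≤ (divisibleForms o K j).map φ →
        (divisibleForms o K (j + m + 1)).map φ ≤ (divisibleForms o K (j + m)).map φ := by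
      intro j m
      induction m with
      | zero => exact fun _ h => h
      | succ m ih =>
        intro hm hj
        exact map_divisibleForms_le_succ hφ o (j := j + m) (by omega) (ih (by omega) hj)
    have hlt : ∀ j ≤ K, (divisibleForms o K j).map φ < (divisibleForms o K (j + 1)).map φ := by
      intro j hj
      refine lt_of_le_not_ge (Submodule.map_mono (divisibleForms_mono o K (by omega))) fun hle => h ?_
      have := hstep j (K - j) (by omega) hle
      rwa [show j + (K - j) = K by omega] at this
    have hfin : ∀ j ≤ K + 1, j ≤ Module.finrank ℝ ((divisibleForms o K j).map φ) := by
      intro j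
      induction j with
      | zero => exact fun _ => Nat.zero_le _
      | succ j ih =>
        intro hj
        have h1 := ih (by omega)
        have h2 := Submodule.finrank_lt_finrank_of_lt (hlt j (by omega))
        omega
    have hle : (divisibleForms o K (K + 1)).map φ ≤ (homogeneousSubmodule ι ℝ (K + 1)).map φ :=
      Submodule.map_mono fun f hf => hf.1
    have heq := Submodule.eq_of_le_of_finrank_le hle (hrank.trans (hfin _ le_rfl))
    obtain ⟨f, hf, rfl⟩ := hw
    obtain ⟨p, hp, rfl⟩ := mem_divisibleForms_succ.1 hf
    refine ⟨p, hp, rfl, fun i => ?_⟩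
    rw [heq]
    exact ⟨_, isHomogeneous_X_mul i hp, rfl⟩

/-- This exchange of variables gives well-definedness, symmetry and commutation of the
multiplication operators. -/
theorem IsHankelGram.inner_X_mul {K : ℕ} {φ : MvPolynomial ι ℝ →ₗ[ℝ] E}
    (hφ : IsHankelGram (K + 1) φ) (i l : ι) {p q : MvPolynomial ι ℝ} (hp : p.IsHomogeneous K)
    (hq : q.IsHomogeneous K) :
    inner ℝ (φ (X i * p)) (φ (X l * q)) = inner ℝ (φ (X l * p)) (φ (X i * q)) :=
  hφ _ _ _ _ (isHomogeneous_X_mul i hp) (isHomogeneous_X_mul l hq) (isHomogeneous_X_mul l hp)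
    (isHomogeneous_X_mul i hq) (by ring)

/-! ### Multiplication operators and the atomic decomposition -/

variable [FiniteDimensional ℝ E]

/-- Compressed multiplication operators: on the image `F` of the multiples of `X o`, the rule
`φ (X o * p) ↦ P_F (φ (X i * p))` defines commuting symmetric operators. -/
theorem exists_multiplication_operators {K : ℕ} {φ : MvPolynomial ι ℝ →ₗ[ℝ] E}
    (hφ : IsHankelGram (K + 1) φ) (o : ι)
    (hrank : Module.finrank ℝ ((homogeneousSubmodule ι ℝ (K + 1)).map φ) ≤ K + 1)
    {F : Submodule ℝ E} (hF : F = (divisibleForms o K (K + 1)).map φ) :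
    ∃ M : ι → F →ₗ[ℝ] F, (∀ i, (M i).IsSymmetric) ∧ (∀ i j, Commute (M i) (M j)) ∧
      ∀ i, ∀ p : MvPolynomial ι ℝ, p.IsHomogeneous K → ∀ w : F, (w : E) = φ (X o * p) →
        M i w = F.orthogonalProjectionOnto (φ (X i * p)) := by
  have hmem : ∀ p : MvPolynomial ι ℝ, p.IsHomogeneous K → φ (X o * p) ∈ F := fun p hp => by
    rw [hF]
    exact ⟨_, mem_divisibleForms_succ.2 ⟨p, hp, rfl⟩, rfl⟩
  have hrep : ∀ w : F, ∃ p : MvPolynomial ι ℝ, p.IsHomogeneous K ∧ φ (X o * p) = w ∧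
      ∀ i, φ (X i * p) ∈ F := by
    intro w
    have := exists_repr_of_finrank_le hφ o hrank (w := w) (by rw [← hF]; exact w.2)
    rwa [← hF] at this
  let g : homogeneousSubmodule ι ℝ K →ₗ[ℝ] F :=
    (φ ∘ₗ LinearMap.mulLeft ℝ (X o) ∘ₗ (homogeneousSubmodule ι ℝ K).subtype).codRestrict F
      (fun p => hmem p p.2)
  have hg : LinearMap.range g = ⊤ := by
    rw [LinearMap.range_eq_top]
    intro w
    obtain ⟨p, hp, hw, -⟩ := hrep w
    exact ⟨⟨p, hp⟩, Subtype.ext hw⟩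
  obtain ⟨s, hs⟩ := g.exists_rightInverse_of_surjective hg
  let M : ι → F →ₗ[ℝ] F := fun i =>
    (F.orthogonalProjectionOnto : E →ₗ[ℝ] F) ∘ₗ φ ∘ₗ LinearMap.mulLeft ℝ (X i) ∘ₗ
      (homogeneousSubmodule ι ℝ K).subtype ∘ₗ s
  have hMs : ∀ i w, M i w = F.orthogonalProjectionOnto (φ (X i * (s w : MvPolynomial ι ℝ))) :=
    fun i w => rfl
  have hsw : ∀ w : F, φ (X o * (s w : MvPolynomial ι ℝ)) = w := fun w =>
    congrArg Subtype.val (LinearMap.congr_fun hs w)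
  -- Independence of the section `s`: paired with `φ (X o * q)`, the projection of `φ (X i * p)`
  -- gives the inner product of `φ (X o * p)` with `φ (X i * q)`.
  have hM : ∀ i, ∀ p : MvPolynomial ι ℝ, p.IsHomogeneous K → ∀ w : F, (w : E) = φ (X o * p) →
      M i w = F.orthogonalProjectionOnto (φ (X i * p)) := by
    intro i p hp w hw
    refine ext_inner_right ℝ fun v => ?_
    obtain ⟨q, hq, hv, -⟩ := hrep v
    rw [hMs, Submodule.inner_orthogonalProjectionOnto_eq_of_mem_right,
      Submodule.inner_orthogonalProjectionOnto_eq_of_mem_right, ← hv,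
      hφ.inner_X_mul i o (s w).2 hq, hφ.inner_X_mul i o hp hq, hsw, hw]
  have hsymm : ∀ i, (M i).IsSymmetric := by
    intro i u v
    rw [hMs, hMs, Submodule.inner_orthogonalProjectionOnto_eq_of_mem_right,
      Submodule.inner_orthogonalProjectionOnto_eq_of_mem_left, ← hsw v,
      hφ.inner_X_mul i o (s u).2 (s v).2, hsw u]
  refine ⟨M, hsymm, fun i j => ?_, hM⟩
  -- The projections disappear once one of the two representatives has all its `φ (X j * p)` in `F`;
  -- the result is then symmetric in `i` and `j`.
  have key : ∀ i, ∀ u v : F, ∀ p q : MvPolynomial ι ℝ, p.IsHomogeneous K → q.IsHomogeneous K →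
      (u : E) = φ (X o * p) → (v : E) = φ (X o * q) → (∀ i, φ (X i * p) ∈ F) → ∀ j,
      inner ℝ (M i (M j u)) v = inner ℝ (φ (X j * p)) (φ (X i * q)) := by
    intro i u v p q hp hq hu hv hpF j
    rw [hsymm i, hM j p hp u hu, hM i q hq v hv,
      Submodule.inner_orthogonalProjectionOnto_eq_of_mem_left,
      Submodule.coe_orthogonalProjectionOnto_apply, Submodule.starProjection_eq_self_iff.2 (hpF j)]
  refine LinearMap.ext fun u => ext_inner_right ℝ fun v => ?_
  obtain ⟨p, hp, hu, hpF⟩ := hrep u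
  obtain ⟨q, hq, hv, -⟩ := hrep v
  rw [Module.End.mul_apply, Module.End.mul_apply, key i u v p q hp hq hu.symm hv.symm hpF,
    key j u v p q hp hq hu.symm hv.symm hpF, hφ.inner_X_mul j i hp hq]

/-- The compression of `φ` to the image of the multiples of `X o` is a sum of point evaluations
at points with `o`-th coordinate `1`, with pairwise orthogonal coefficients. -/
theorem exists_projection_eq_sum {K : ℕ} {φ : MvPolynomial ι ℝ →ₗ[ℝ] E}
    (hφ : IsHankelGram (K + 1) φ) (o : ι)
    (hrank : Module.finrank ℝ ((homogeneousSubmodule ι ℝ (K + 1)).map φ) ≤ K + 1)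
    {F : Submodule ℝ E} (hF : F = (divisibleForms o K (K + 1)).map φ) :
    ∃ f : (ι → ℝ) →₀ F, (∀ a ∈ f.support, a o = 1) ∧
      (∀ a b, a ≠ b → inner ℝ (f a) (f b) = 0) ∧
      ∀ p : MvPolynomial ι ℝ, p.IsHomogeneous (K + 1) →
        F.orthogonalProjectionOnto (φ p) = f.sum fun a v => eval a p • v := by
  obtain ⟨M, hsymm, hcomm, hM⟩ := exists_multiplication_operators hφ o hrank hF
  have hmem : ∀ p : MvPolynomial ι ℝ, p.IsHomogeneous K → φ (X o * p) ∈ F := fun p hp => by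
    rw [hF]
    exact ⟨_, mem_divisibleForms_succ.2 ⟨p, hp, rfl⟩, rfl⟩
  have hXK : (X o ^ K : MvPolynomial ι ℝ).IsHomogeneous K := isHomogeneous_X_pow o K
  obtain ⟨f, hf, horth, hsum⟩ :=
    exists_joint_eigenvector_sum M hsymm hcomm ⟨φ (X o * X o ^ K), hmem _ hXK⟩
  refine ⟨f, fun a ha => ?_, horth, ?_⟩
  · have hMo : M o (f a) = f a := by
      obtain ⟨_, hb, hbe⟩ := hF.le (f a).2
      obtain ⟨p, hp, rfl⟩ := mem_divisibleForms_succ.1 hb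
      rw [hM o p hp (f a) hbe.symm, hbe,
        Submodule.orthogonalProjectionOnto_mem_subspace_eq_self]
    have h1 := hf a o
    rw [hMo] at h1
    have h2 : (a o - 1) • f a = 0 := by rw [sub_smul, ← h1, one_smul, sub_self]
    exact sub_eq_zero.1 ((smul_eq_zero.1 h2).resolve_right (Finsupp.mem_support_iff.1 ha))
  -- Starting from `X o ^ (K + 1)`, each factor `X o` replaced by `X i` applies `M i`, which
  -- multiplies `f a` by `a i`. The last replacement leaves no `X o`, hence the projection.
  · have key : ∀ d ≤ K + 1, ∀ p : MvPolynomial ι ℝ, p.IsHomogeneous d →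
        F.orthogonalProjectionOnto (φ (X o ^ (K + 1 - d) * p)) =
          ∑ a ∈ f.support, eval a p • f a := by
      intro d
      induction d with
      | zero =>
        intro _ p hp
        obtain ⟨c, rfl⟩ : ∃ c, p = C c := ⟨_, (totalDegree_eq_zero_iff_eq_C).1
          (Nat.le_zero.1 hp.totalDegree_le)⟩
        have h1 : X o ^ (K + 1 - 0) * C c = c • (X o * X o ^ K : MvPolynomial ι ℝ) := by
          rw [smul_eq_C_mul, Nat.sub_zero]; ring
        have h2 : F.orthogonalProjectionOnto (φ (X o * X o ^ K)) = ∑ a ∈ f.support, f a := by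
          exact (Submodule.orthogonalProjectionOnto_mem_subspace_eq_self
            (⟨φ (X o * X o ^ K), hmem _ hXK⟩ : F)).trans hsum.symm
        rw [h1, map_smul, map_smul, h2, Finset.smul_sum]
        simp
      | succ d ih =>
        intro hd p hp
        let A : MvPolynomial ι ℝ →ₗ[ℝ] F := (F.orthogonalProjectionOnto : E →ₗ[ℝ] F) ∘ₗ φ ∘ₗ
          LinearMap.mulLeft ℝ (X o ^ (K + 1 - (d + 1)))
        let B : MvPolynomial ι ℝ →ₗ[ℝ] F :=
          ∑ a ∈ f.support, (aeval a : MvPolynomial ι ℝ →ₐ[ℝ] ℝ).toLinearMap.smulRight (f a)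
        have hB : ∀ p, B p = ∑ a ∈ f.support, eval a p • f a := fun p => by
          simp [B, LinearMap.sum_apply, aeval_eq_eval]
        have hAB : p ∈ LinearMap.eqLocus A B := by
          refine isHomogeneous_succ_mem (fun i q hq => ?_) hp
          have hqK : (X o ^ (K - d) * q).IsHomogeneous K := by
            convert isHomogeneous_X_pow_mul o (K - d) hq using 1
            omega
          have h3 := ih (by omega) q hq
          rw [LinearMap.mem_eqLocus, hB]
          have h4 : A (X i * q) = M i ⟨φ (X o * (X o ^ (K - d) * q)), hmem _ hqK⟩ := by
            rw [hM i _ hqK _ rfl]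
            change F.orthogonalProjectionOnto (φ (X o ^ (K + 1 - (d + 1)) * (X i * q))) = _
            congr 2
            rw [show K + 1 - (d + 1) = K - d by omega]
            ring
          have h5 : (⟨φ (X o * (X o ^ (K - d) * q)), hmem _ hqK⟩ : F) =
              ∑ a ∈ f.support, eval a q • f a := by
            rw [← h3, ← Submodule.orthogonalProjectionOnto_mem_subspace_eq_self
              (⟨φ (X o * (X o ^ (K - d) * q)), hmem _ hqK⟩ : F)]
            have h6 : X o ^ (K + 1 - d) * q = X o * (X o ^ (K - d) * q) := by
              rw [← mul_assoc, ← pow_succ', show K - d + 1 = K + 1 - d by omega]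
            rw [h6]
          rw [h4, h5, map_sum]
          refine Finset.sum_congr rfl fun a _ => ?_
          rw [map_smul, hf, smul_smul, map_mul, eval_X, mul_comm]
        have := LinearMap.mem_eqLocus.1 hAB
        rw [hB] at this
        exact this
    intro p hp
    have := key (K + 1) le_rfl p hp
    rwa [Nat.sub_self, pow_zero, one_mul] at this

/-- A Hankel Gram form on forms of degree `k = K + 1` of rank at most `k` is a nonnegative
combination of point evaluations at nonzero points. -/
theorem exists_atomic_of_finrank_le {ι : Type} {K : ℕ} (T : Finset ι) :
    ∀ φ : MvPolynomial ι ℝ →ₗ[ℝ] E, IsHankelGram (K + 1) φ →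
    Module.finrank ℝ ((homogeneousSubmodule ι ℝ (K + 1)).map φ) ≤ K + 1 →
    (∀ i ∉ T, ∀ p : MvPolynomial ι ℝ, p.IsHomogeneous K → φ (X i * p) = 0) →
    ∃ (κ : Type) (_ : Fintype κ) (u : κ → ℝ) (η : κ → ι → ℝ), (∀ c, 0 ≤ u c) ∧
      (∀ c, η c ≠ 0) ∧ ∀ p q : MvPolynomial ι ℝ, p.IsHomogeneous (K + 1) →
        q.IsHomogeneous (K + 1) →
        inner ℝ (φ p) (φ q) = ∑ c, u c * (eval (η c) p * eval (η c) q) := by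
  classical
  induction T using Finset.induction_on with
  | empty =>
    intro φ _ _ h0
    refine ⟨Empty, inferInstance, Empty.elim, Empty.elim, fun c => c.elim, fun c => c.elim,
      fun p q hp _ => ?_⟩
    have : p ∈ LinearMap.ker φ :=
      isHomogeneous_succ_mem (fun i r hr => LinearMap.mem_ker.2 (h0 i (by simp) r hr)) hp
    rw [LinearMap.mem_ker.1 this, inner_zero_left]
    simp
  | insert o T ho ih =>
    intro φ hφ hrank h0
    obtain ⟨F, hF⟩ : ∃ F : Submodule ℝ E, F = (divisibleForms o K (K + 1)).map φ := ⟨_, rfl⟩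
    obtain ⟨f, hf1, horth, hsum⟩ := exists_projection_eq_sum hφ o hrank hF
    set A : E →ₗ[ℝ] E := LinearMap.id - (F.starProjection : E →ₗ[ℝ] E) with hA
    have hAx : ∀ x, A x = x - F.starProjection x := fun x => rfl
    have hsplit : ∀ x y : E, inner ℝ x y = inner ℝ (F.orthogonalProjectionOnto x)
        (F.orthogonalProjectionOnto y) + inner ℝ (A x) (A y) := by
      intro x y
      have h1 : inner ℝ (A x) (F.starProjection y) = 0 :=
        Submodule.starProjection_inner_eq_zero _ _ (Submodule.starProjection_apply_mem _ _)
      have h2 : inner ℝ (F.starProjection x) (A y) = 0 := by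
        rw [real_inner_comm]
        exact Submodule.starProjection_inner_eq_zero _ _ (Submodule.starProjection_apply_mem _ _)
      rw [Submodule.coe_inner, Submodule.coe_orthogonalProjectionOnto_apply,
        Submodule.coe_orthogonalProjectionOnto_apply]
      have hx : x = F.starProjection x + A x := by rw [hAx]; abel
      have hy : y = F.starProjection y + A y := by rw [hAx]; abel
      conv_lhs => rw [hx, hy]
      rw [inner_add_left, inner_add_right, inner_add_right, h1, h2]
      ring
    have hproj : ∀ p q : MvPolynomial ι ℝ, p.IsHomogeneous (K + 1) → q.IsHomogeneous (K + 1) →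
        inner ℝ (F.orthogonalProjectionOnto (φ p)) (F.orthogonalProjectionOnto (φ q)) =
          ∑ a ∈ f.support, inner ℝ (f a) (f a) * (eval a p * eval a q) := by
      intro p q hp hq
      rw [hsum p hp, hsum q hq, Finsupp.sum, Finsupp.sum, sum_inner]
      refine Finset.sum_congr rfl fun a ha => ?_
      rw [inner_sum, Finset.sum_eq_single a]
      · rw [real_inner_smul_left, real_inner_smul_right]
        ring
      · intro b _ hb
        rw [real_inner_smul_left, real_inner_smul_right, horth a b hb.symm]
        ring
      · exact fun h => absurd ha h
    -- The split-off part is a sum of evaluations, which depends only on `p * q`; hence so does the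
    -- remainder.
    have hAφ : IsHankelGram (K + 1) (A ∘ₗ φ) := by
      intro p q p' q' hp hq hp' hq' h
      have h1 := hφ p q p' q' hp hq hp' hq' h
      rw [hsplit (φ p), hsplit (φ p'), hproj p q hp hq, hproj p' q' hp' hq'] at h1
      simp only [← map_mul, h] at h1
      exact add_left_cancel h1
    have hArank : Module.finrank ℝ ((homogeneousSubmodule ι ℝ (K + 1)).map (A ∘ₗ φ)) ≤ K + 1 := by
      rw [Submodule.map_comp]
      exact (Submodule.finrank_map_le _ _).trans hrank
    have hA0 : ∀ i ∉ T, ∀ p : MvPolynomial ι ℝ, p.IsHomogeneous K → (A ∘ₗ φ) (X i * p) = 0 := by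
      intro i hi p hp
      rw [LinearMap.comp_apply]
      by_cases hio : i = o
      · subst hio
        rw [hAx, Submodule.starProjection_eq_self_iff.2, sub_self]
        rw [hF]
        exact ⟨_, mem_divisibleForms_succ.2 ⟨p, hp, rfl⟩, rfl⟩
      · rw [h0 i (by simp [hi, hio]) p hp, map_zero]
    obtain ⟨κ, _, u, η, hu, hη, h⟩ := ih _ hAφ hArank hA0
    refine ⟨f.support ⊕ κ, inferInstance, Sum.elim (fun a => inner ℝ (f a) (f a)) u,
      Sum.elim (fun a => a) η, ?_, ?_, fun p q hp hq => ?_⟩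
    · rintro (a | c)
      · exact real_inner_self_nonneg
      · exact hu c
    · rintro (a | c)
      · intro h
        have h1 := hf1 a a.2
        rw [show (a : ι → ℝ) = 0 from h] at h1
        simp at h1
      · exact hη c
    · rw [hsplit, hproj p q hp hq, Fintype.sum_sum_type]
      congr 1
      · exact (Finset.sum_coe_sort f.support
          (fun a => inner ℝ (f a) (f a) * (eval a p * eval a q))).symm
      · exact h p q hp hq

end Homogeneous

/-! ### Gram maps, homogenization and atoms at infinity -/

/-- A positive semidefinite symmetric form is the Gram form of a linear map of the same rank to a
finite-dimensional Euclidean space. -/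
theorem exists_gram_map {V : Type} [AddCommGroup V] [Module ℝ V] [FiniteDimensional ℝ V]
    (B : V →ₗ[ℝ] Module.Dual ℝ V) (hsymm : ∀ x y, B x y = B y x) (hpos : ∀ x, 0 ≤ B x x) :
    ∃ (E : Type) (_ : NormedAddCommGroup E) (_ : InnerProductSpace ℝ E)
      (_ : FiniteDimensional ℝ E) (φ : V →ₗ[ℝ] E),
      (∀ x y, inner ℝ (φ x) (φ y) = B x y) ∧
      Module.finrank ℝ (LinearMap.range φ) = Module.finrank ℝ (LinearMap.range B) := by
  let c : PreInnerProductSpace.Core ℝ V :=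
    { inner := fun x y => B x y
      conj_inner_symm := fun x y => hsymm y x
      re_inner_nonneg := fun x => hpos x
      add_left := fun x y z => by simp
      smul_left := fun x y r => by simp }
  let : SeminormedAddCommGroup V := InnerProductSpace.Core.toSeminormedAddCommGroup (c := c)
  let : InnerProductSpace ℝ V := InnerProductSpace.ofCore c
  -- Quotient by the null vectors of the seminorm; by Cauchy–Schwarz these form the kernel of `B`.
  let φ : V →ₗ[ℝ] SeparationQuotient V := (SeparationQuotient.mkCLM ℝ V : V →ₗ[ℝ] _)
  have hφ : ∀ x y, inner ℝ (φ x) (φ y) = B x y := fun x y => rfl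
  have hfd : FiniteDimensional ℝ (SeparationQuotient V) :=
    Module.Finite.of_surjective φ (fun y => by
      obtain ⟨x, rfl⟩ := SeparationQuotient.surjective_mk y
      exact ⟨x, rfl⟩)
  refine ⟨SeparationQuotient V, inferInstance, inferInstance, hfd, φ, hφ, ?_⟩
  have hker : LinearMap.ker φ = LinearMap.ker B := by
    ext x
    rw [LinearMap.mem_ker, LinearMap.mem_ker]
    constructor
    · intro h
      ext y
      rw [← hφ, h, inner_zero_left, LinearMap.zero_apply]
    · intro h
      rw [← inner_self_eq_zero (𝕜 := ℝ), hφ, h, LinearMap.zero_apply]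
  have h1 := LinearMap.finrank_range_add_finrank_ker φ
  have h2 := LinearMap.finrank_range_add_finrank_ker B
  rw [hker] at h1
  omega

instance finiteDimensional_polyLE (n d : ℕ) : FiniteDimensional ℝ (PolyLE n d) := by
  let b := fun α : Expo n d => (monomial α.1 (1 : ℝ) : MvPolynomial (Fin n) ℝ)
  have hle : PolyLE n d ≤ Submodule.span ℝ (Set.range b) := by
    intro f hf
    rw [← support_sum_monomial_coeff f]
    refine Submodule.sum_mem _ fun m hm => ?_
    have hm' : m.degree ≤ d := (le_totalDegree hm).trans ((mem_restrictTotalDegree _ _ _).1 hf)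
    rw [← mul_one (coeff m f), ← smul_eq_mul, ← smul_monomial]
    exact Submodule.smul_mem _ _ (Submodule.subset_span ⟨⟨m, hm'⟩, rfl⟩)
  have : FiniteDimensional ℝ (Submodule.span ℝ (Set.range b)) :=
    FiniteDimensional.span_of_finite ℝ (Set.finite_range b)
  exact Submodule.finiteDimensional_of_le hle

theorem hankel_apply {n k : ℕ} (σ : Module.Dual ℝ (PolyLE n (2 * k))) (p q : PolyLE n k) :
    hankel σ p q = σ ⟨(p : MvPolynomial (Fin n) ℝ) * q, mul_mem p q⟩ := rfl

/-- A subspace containing the monomials of degree at most `d` contains all polynomials of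
degree at most `d`. -/
theorem polyLE_le {n d : ℕ} {N : Submodule ℝ (MvPolynomial (Fin n) ℝ)}
    (h : ∀ α : Fin n →₀ ℕ, α.degree ≤ d → monomial α (1 : ℝ) ∈ N) : PolyLE n d ≤ N := by
  intro f hf
  rw [← support_sum_monomial_coeff f]
  refine Submodule.sum_mem _ fun m hm => ?_
  have hm' : m.degree ≤ d := (le_totalDegree hm).trans ((mem_restrictTotalDegree _ _ _).1 hf)
  rw [← mul_one (coeff m f), ← smul_eq_mul, ← smul_monomial]
  exact Submodule.smul_mem _ _ (h m hm')

/-- A subspace containing all products of forms of degrees `a` and `b` contains all forms of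
degree `a + b`. -/
theorem isHomogeneous_add_mem {ι : Type*} (a : ℕ) {b : ℕ} :
    ∀ {N : Submodule ℝ (MvPolynomial ι ℝ)}, (∀ p q : MvPolynomial ι ℝ, p.IsHomogeneous a →
      q.IsHomogeneous b → p * q ∈ N) → ∀ {f : MvPolynomial ι ℝ}, f.IsHomogeneous (a + b) →
      f ∈ N := by
  induction a with
  | zero =>
    intro N hN f hf
    have := hN 1 f (isHomogeneous_one _ _) (by rwa [zero_add] at hf)
    rwa [one_mul] at this
  | succ a ih =>
    intro N hN f hf
    refine isHomogeneous_succ_mem (d := a + b) (fun i p hp => ?_) (by rwa [add_right_comm] at hf)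
    refine ih (N := N.comap (LinearMap.mulLeft ℝ (X i))) (fun p q hp hq => ?_) hp
    rw [Submodule.mem_comap, LinearMap.mulLeft_apply, ← mul_assoc]
    exact hN _ _ (isHomogeneous_X_mul i hp) hq

/-- Setting the variable `none` to `1`. -/
def dehomogenize (n : ℕ) : MvPolynomial (Option (Fin n)) ℝ →ₐ[ℝ] MvPolynomial (Fin n) ℝ :=
  aeval fun o => o.elim 1 X

theorem dehomogenize_mem {n d : ℕ} : ∀ {p : MvPolynomial (Option (Fin n)) ℝ},
    p.IsHomogeneous d → dehomogenize n p ∈ PolyLE n d := by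
  induction d with
  | zero =>
    intro p hp
    obtain ⟨c, rfl⟩ : ∃ c, p = C c := ⟨_, (totalDegree_eq_zero_iff_eq_C).1
      (Nat.le_zero.1 hp.totalDegree_le)⟩
    rw [mem_restrictTotalDegree, dehomogenize, aeval_C, algebraMap_eq, totalDegree_C]
  | succ d ih =>
    intro p hp
    refine isHomogeneous_succ_mem (N := (PolyLE n (d + 1)).comap (dehomogenize n).toLinearMap)
      (fun i q hq => ?_) hp
    have h1 := (mem_restrictTotalDegree _ _ _).1 (ih hq)
    rw [Submodule.mem_comap, AlgHom.toLinearMap_apply, map_mul, mem_restrictTotalDegree]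
    refine (totalDegree_mul _ _).trans ?_
    have h2 : (dehomogenize n (X i)).totalDegree ≤ 1 := by
      rw [dehomogenize, aeval_X]
      rcases i with _ | i
      · simp
      · simp
    omega

theorem eval_smul_monomial {n : ℕ} (t : ℝ) (x : Fin n → ℝ) (α : Fin n →₀ ℕ) :
    eval (t • x) (monomial α (1 : ℝ)) = t ^ α.degree * eval x (monomial α (1 : ℝ)) := by
  simp only [eval_monomial, one_mul, Pi.smul_apply, smul_eq_mul, mul_pow, Finsupp.prod_mul]
  congr 1
  rw [Finsupp.prod, Finset.prod_pow_eq_pow_sum]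
  rfl

theorem homogeneousComponent_monomial_one {n : ℕ} (d : ℕ) (α : Fin n →₀ ℕ) :
    homogeneousComponent d (monomial α (1 : ℝ)) =
      if α.degree = d then monomial α (1 : ℝ) else 0 := by
  have := homogeneousComponent_of_mem (m := d)
    ((mem_homogeneousSubmodule _ _).2 (isHomogeneous_monomial (d := α) (1 : ℝ) rfl))
  rw [this]
  split_ifs with h1 h2 h2 <;> first | rfl | exact absurd h1.symm h2 | exact absurd h2.symm h1

/-- A positive semidefinite Hankel operator on `R_k` of rank at most `k` is a nonnegative
combination of evaluations at points and at points at infinity. -/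
theorem exists_atomic_at_infinity {n K : ℕ} (σ : Module.Dual ℝ (PolyLE n (2 * (K + 1))))
    (hpsd : IsPSD (hankel σ))
    (hrank : Module.finrank ℝ (LinearMap.range (hankel σ)) ≤ K + 1) :
    ∃ (κ : Type) (_ : Fintype κ) (u : κ → ℝ) (ζ : κ → Fin n → ℝ)
      (κ' : Type) (_ : Fintype κ') (u' : κ' → ℝ) (η : κ' → Fin n → ℝ),
      (∀ c, 0 ≤ u c) ∧ (∀ c, 0 ≤ u' c) ∧ (∀ c, η c ≠ 0) ∧
      ∀ f : PolyLE n (2 * (K + 1)), σ f = ∑ c, u c * eval (ζ c) (f : MvPolynomial (Fin n) ℝ) +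
        ∑ c, u' c * eval (η c) (homogeneousComponent (2 * (K + 1))
          (f : MvPolynomial (Fin n) ℝ)) := by
  obtain ⟨E, _, _, _, φ₀, hφ₀, hr⟩ := exists_gram_map (hankel σ)
    (fun p q => by rw [hankel_apply, hankel_apply]; congr 2; exact mul_comm _ _) hpsd
  -- The extensions to all polynomials are arbitrary; they are only used within the degree bounds.
  obtain ⟨φ₁, hφ₁⟩ := LinearMap.exists_extend φ₀
  obtain ⟨σ₁, hσ₁⟩ := LinearMap.exists_extend σ
  have hφ₁' : ∀ p : PolyLE n (K + 1), φ₁ p = φ₀ p := fun p => LinearMap.congr_fun hφ₁ p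
  have hσ₁' : ∀ p : PolyLE n (2 * (K + 1)), σ₁ p = σ p := fun p => LinearMap.congr_fun hσ₁ p
  have hgram : ∀ p q : MvPolynomial (Option (Fin n)) ℝ, p.IsHomogeneous (K + 1) →
      q.IsHomogeneous (K + 1) →
      inner ℝ ((φ₁ ∘ₗ (dehomogenize n).toLinearMap) p) ((φ₁ ∘ₗ (dehomogenize n).toLinearMap) q) =
        (σ₁ ∘ₗ (dehomogenize n).toLinearMap) (p * q) := by
    intro p q hp hq
    simp only [LinearMap.comp_apply, AlgHom.toLinearMap_apply]
    rw [hφ₁' ⟨_, dehomogenize_mem hp⟩, hφ₁' ⟨_, dehomogenize_mem hq⟩, hφ₀, hankel_apply, ← hσ₁',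
      map_mul (dehomogenize n)]
  have hH : IsHankelGram (K + 1) (φ₁ ∘ₗ (dehomogenize n).toLinearMap) := by
    intro p q p' q' hp hq hp' hq' h
    rw [hgram p q hp hq, hgram p' q' hp' hq', h]
  have hrk : Module.finrank ℝ ((homogeneousSubmodule (Option (Fin n)) ℝ (K + 1)).map
      (φ₁ ∘ₗ (dehomogenize n).toLinearMap)) ≤ K + 1 := by
    refine (Submodule.finrank_mono ?_).trans (hr.le.trans hrank)
    rintro _ ⟨p, hp, rfl⟩
    exact ⟨⟨_, dehomogenize_mem hp⟩, (hφ₁' ⟨_, dehomogenize_mem hp⟩).symm⟩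
  obtain ⟨κ, _, u, η, hu, hη, hsum⟩ := exists_atomic_of_finrank_le Finset.univ _ hH hrk
    (fun i hi => absurd (Finset.mem_univ i) hi)
  have hsum' : ∀ f : MvPolynomial (Option (Fin n)) ℝ, f.IsHomogeneous (2 * (K + 1)) →
      σ₁ (dehomogenize n f) = ∑ c, u c * eval (η c) f := by
    intro f hf
    let R : MvPolynomial (Option (Fin n)) ℝ →ₗ[ℝ] ℝ :=
      ∑ c, u c • (aeval (η c) : MvPolynomial (Option (Fin n)) ℝ →ₐ[ℝ] ℝ).toLinearMap
    have hR : ∀ f, R f = ∑ c, u c * eval (η c) f := fun f => by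
      simp [R, LinearMap.sum_apply, aeval_eq_eval]
    rw [← hR]
    refine isHomogeneous_add_mem (K + 1) (b := K + 1)
      (N := LinearMap.eqLocus (σ₁ ∘ₗ (dehomogenize n).toLinearMap) R) (fun p q hp hq => ?_)
      (by rwa [two_mul] at hf)
    rw [LinearMap.mem_eqLocus, ← hgram p q hp hq, hsum p q hp hq, hR]
    simp only [map_mul]
  classical
  -- Atoms off the hyperplane at infinity are rescaled to last coordinate `1`; the weight absorbs an
  -- even power, so it stays nonnegative.
  refine ⟨{c // η c none ≠ 0}, inferInstance, fun c => u c * η c none ^ (2 * (K + 1)),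
    fun c => (η c none)⁻¹ • fun j => η c (some j),
    {c // ¬ η c none ≠ 0}, inferInstance, fun c => u c, fun c j => η c (some j), ?_, ?_, ?_, ?_⟩
  · exact fun c => mul_nonneg (hu c) (Even.pow_nonneg (even_two_mul _) _)
  · exact fun c => hu c
  · intro c h
    refine hη c (funext fun o => ?_)
    rcases o with _ | j
    · exact not_not.1 c.2
    · exact congrFun h j
  · let R : MvPolynomial (Fin n) ℝ →ₗ[ℝ] ℝ :=
      ∑ c : {c // η c none ≠ 0}, (u c * η c none ^ (2 * (K + 1))) •
        (aeval ((η c none)⁻¹ • fun j => η c (some j)) :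
          MvPolynomial (Fin n) ℝ →ₐ[ℝ] ℝ).toLinearMap +
      ∑ c : {c // ¬ η c none ≠ 0}, u c •
        (aeval (fun j => η c (some j)) : MvPolynomial (Fin n) ℝ →ₐ[ℝ] ℝ).toLinearMap ∘ₗ
          homogeneousComponent (2 * (K + 1))
    have hR : ∀ f, R f = ∑ c : {c // η c none ≠ 0}, (u c * η c none ^ (2 * (K + 1))) *
          eval ((η c none)⁻¹ • fun j => η c (some j)) f +
        ∑ c : {c // ¬ η c none ≠ 0}, u c *
          eval (fun j => η c (some j)) (homogeneousComponent (2 * (K + 1)) f) := fun f => by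
      simp only [R, LinearMap.add_apply, LinearMap.sum_apply, LinearMap.smul_apply,
        LinearMap.comp_apply, AlgHom.toLinearMap_apply, aeval_eq_eval, smul_eq_mul]
    intro f
    rw [← hR, ← hσ₁']
    refine polyLE_le (N := LinearMap.eqLocus σ₁ R) (fun α hα => ?_) f.2
    rw [LinearMap.mem_eqLocus, hR]
    -- Homogenized monomial: at an atom with `η c none = 0` it survives only if `α` has full degree.
    have hhom : (X none ^ (2 * (K + 1) - α.degree) *
        rename some (monomial α (1 : ℝ)) : MvPolynomial (Option (Fin n)) ℝ).IsHomogeneous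
          (2 * (K + 1)) := by
      convert isHomogeneous_X_pow_mul none (2 * (K + 1) - α.degree)
        ((isHomogeneous_monomial (1 : ℝ) (rfl : α.degree = α.degree)).rename_isHomogeneous
          (f := some)) using 1
      omega
    have hde : dehomogenize n (X none ^ (2 * (K + 1) - α.degree) *
        rename some (monomial α (1 : ℝ))) = monomial α 1 := by
      rw [map_mul, map_pow, dehomogenize, aeval_X, aeval_rename, Option.elim_none, one_pow,
        one_mul]
      exact aeval_X_left_apply _
    have h := hsum' _ hhom
    rw [hde] at h
    rw [h, ← Fintype.sum_subtype_add_sum_subtype (fun c => η c none ≠ 0)]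
    congr 1
    · refine Finset.sum_congr rfl fun c _ => ?_
      rw [map_mul, map_pow, eval_X, eval_rename, eval_smul_monomial, mul_assoc]
      congr 1
      rw [← mul_assoc]
      congr 1
      rw [inv_pow, pow_sub₀ _ c.2 hα]
    · refine Finset.sum_congr rfl fun c _ => ?_
      rw [map_mul, map_pow, eval_X, eval_rename, not_not.1 c.2, homogeneousComponent_monomial_one]
      congr 1
      split_ifs with h1
      · rw [h1, Nat.sub_self, pow_zero, one_mul]
        rfl
      · rw [zero_pow (by omega), zero_mul, map_zero]

/-! ### Counting atoms by the rank -/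

/-- A nonnegative finite combination of values can be rewritten as a positive combination over a
finite set of points. -/
theorem exists_finset_weights {κ X : Type*} [Fintype κ] (u : κ → ℝ) (hu : ∀ c, 0 ≤ u c)
    (ζ : κ → X) : ∃ (s : Finset X) (w : X → ℝ), (∀ x ∈ s, 0 < w x) ∧
      ∀ g : X → ℝ, ∑ c, u c * g (ζ c) = ∑ x ∈ s, w x * g x := by
  classical
  let w : X → ℝ := fun x => ∑ c with ζ c = x, u c
  have hw : ∀ x, 0 ≤ w x := fun x => Finset.sum_nonneg fun c _ => hu c
  refine ⟨(Finset.univ.image ζ).filter fun x => 0 < w x, w, fun x hx => (Finset.mem_filter.1 hx).2,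
    fun g => ?_⟩
  -- Points of total weight zero are discarded, which makes the remaining weights positive.
  rw [Finset.sum_filter_of_ne]
  · rw [← Finset.sum_fiberwise_of_maps_to (g := ζ) (t := Finset.univ.image ζ)
      (fun c hc => Finset.mem_image_of_mem ζ hc)]
    refine Finset.sum_congr rfl fun x _ => ?_
    rw [Finset.sum_mul]
    refine Finset.sum_congr rfl fun c hc => ?_
    rw [(Finset.mem_filter.1 hc).2]
  · intro x _ hx
    refine lt_of_le_of_ne (hw x) fun h => hx ?_
    rw [← h, zero_mul]

/-- Polynomials of degree `d` separate at most `d + 1` points. -/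
theorem exists_separating_polynomial {n d : ℕ} (s : Finset (Fin n → ℝ)) (hs : s.card ≤ d + 1)
    {z : Fin n → ℝ} (hz : z ∈ s) : ∃ p : PolyLE n d,
      eval z (p : MvPolynomial (Fin n) ℝ) = 1 ∧
      ∀ y ∈ s, y ≠ z → eval y (p : MvPolynomial (Fin n) ℝ) = 0 := by
  classical
  have hex : ∀ y : Fin n → ℝ, ∃ l : MvPolynomial (Fin n) ℝ, l.totalDegree ≤ 1 ∧ eval y l = 0 ∧
      (y ≠ z → eval z l ≠ 0) := by
    intro y
    by_cases h : y = z
    · exact ⟨0, by simp, by simp, fun h' => absurd h h'⟩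
    · obtain ⟨j, hj⟩ := Function.ne_iff.1 h
      refine ⟨X j - C (y j), (totalDegree_sub_C_le _ _).trans (totalDegree_X j).le, by simp,
        fun _ => ?_⟩
      simpa [sub_eq_zero] using hj.symm
  choose l hl1 hl0 hlz using hex
  -- At most `d` factors of degree at most one, each nonzero at `z`.
  let q : MvPolynomial (Fin n) ℝ := ∏ y ∈ s.erase z, l y
  have hq : q.totalDegree ≤ d := by
    refine (totalDegree_finsetProd _ _).trans
      ((Finset.sum_le_card_nsmul _ _ 1 fun y _ => hl1 y).trans ?_)
    rw [Finset.card_erase_of_mem hz, smul_eq_mul, mul_one]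
    omega
  have hqz : eval z q ≠ 0 := by
    rw [map_prod]
    exact Finset.prod_ne_zero_iff.2 fun y hy => hlz y (Finset.ne_of_mem_erase hy)
  refine ⟨⟨C (eval z q)⁻¹ * q, ?_⟩, ?_, fun y hy hyz => ?_⟩
  · rw [mem_restrictTotalDegree, C_mul']
    exact (totalDegree_smul_le _ _).trans hq
  · simp [hqz]
  · have : eval y q = 0 := by
      rw [map_prod]
      exact Finset.prod_eq_zero (Finset.mem_erase.2 ⟨hyz, hy⟩) (hl0 y)
    simp [this]

/-- Evaluation of polynomials of degree at most `d` at the points of a finite set. -/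
def evalOn {n : ℕ} (d : ℕ) (s : Finset (Fin n → ℝ)) : PolyLE n d →ₗ[ℝ] (s → ℝ) :=
  LinearMap.pi fun z => evalAt d z

theorem evalAt_apply {n d : ℕ} (z : Fin n → ℝ) (p : PolyLE n d) :
    evalAt d z p = eval z (p : MvPolynomial (Fin n) ℝ) := by
  simp [evalAt, aeval_eq_eval]

theorem mem_ker_evalOn {n d : ℕ} {s : Finset (Fin n → ℝ)} {p : PolyLE n d} :
    p ∈ LinearMap.ker (evalOn d s) ↔ ∀ z ∈ s, eval z (p : MvPolynomial (Fin n) ℝ) = 0 := by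
  rw [LinearMap.mem_ker, funext_iff]
  simp [evalOn, evalAt_apply]

theorem finrank_range_evalOn {n d : ℕ} (s : Finset (Fin n → ℝ)) (hs : s.card ≤ d + 1) :
    Module.finrank ℝ (LinearMap.range (evalOn d s)) = s.card := by
  classical
  have htop : LinearMap.range (evalOn d s) = ⊤ := by
    rw [LinearMap.range_eq_top]
    intro y
    choose p hp1 hp0 using fun z : s => exists_separating_polynomial s hs z.2
    refine ⟨∑ z, y z • p z, funext fun x => ?_⟩
    rw [map_sum, Finset.sum_apply, Finset.sum_eq_single x]
    · simp [evalOn, evalAt_apply, hp1]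
    · intro z _ hz
      have := hp0 z x x.2 (fun h => hz (Subtype.ext h.symm))
      simp [evalOn, evalAt_apply, this]
    · simp
  rw [htop, finrank_top, Module.finrank_fintype_fun_eq_card, Fintype.card_coe]

/-- The rank of the Hankel operator of a positive combination of evaluations is the number of
points, when that rank is at most the degree. -/
theorem card_eq_finrank_range_hankel {n k : ℕ} (σ : Module.Dual ℝ (PolyLE n (2 * k)))
    (s : Finset (Fin n → ℝ)) (w : (Fin n → ℝ) → ℝ) (hw : ∀ z ∈ s, 0 < w z)
    (hσ : ∀ f : PolyLE n (2 * k), σ f = ∑ z ∈ s, w z * eval z (f : MvPolynomial (Fin n) ℝ))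
    (hr : Module.finrank ℝ (LinearMap.range (hankel σ)) ≤ k) :
    s.card = Module.finrank ℝ (LinearMap.range (hankel σ)) := by
  have hH : ∀ p q : PolyLE n k, hankel σ p q = ∑ z ∈ s, w z *
      (eval z (p : MvPolynomial (Fin n) ℝ) * eval z (q : MvPolynomial (Fin n) ℝ)) := by
    intro p q
    rw [hankel_apply, hσ]
    simp only [map_mul]
  -- For `p` in the kernel, the sum of `w z * p(z) ^ 2` vanishes, and the weights are positive.
  have hker : LinearMap.ker (hankel σ) = LinearMap.ker (evalOn k s) := by
    ext p
    rw [mem_ker_evalOn, LinearMap.mem_ker]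
    constructor
    · intro h z hz
      have h1 := hH p p
      rw [h, LinearMap.zero_apply] at h1
      have h2 := (Finset.sum_eq_zero_iff_of_nonneg
        (fun z hz => mul_nonneg (hw z hz).le (mul_self_nonneg _))).1 h1.symm z hz
      exact mul_self_eq_zero.1 ((mul_eq_zero.1 h2).resolve_left (hw z hz).ne')
    · intro h
      ext q
      rw [hH, LinearMap.zero_apply]
      exact Finset.sum_eq_zero fun z hz => by rw [h z hz]; ring
  have hrk := LinearMap.finrank_range_add_finrank_ker (hankel σ)
  have hle : ∀ t ⊆ s, t.card ≤ k + 1 → t.card ≤ Module.finrank ℝ (LinearMap.range (hankel σ)) := by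
    intro t hts ht
    have h1 := LinearMap.finrank_range_add_finrank_ker (evalOn k t)
    rw [finrank_range_evalOn t ht] at h1
    have h2 : LinearMap.ker (hankel σ) ≤ LinearMap.ker (evalOn k t) := by
      rw [hker]
      intro p hp
      exact mem_ker_evalOn.2 fun z hz => mem_ker_evalOn.1 hp z (hts hz)
    have h3 := Submodule.finrank_mono h2
    omega
  -- With more points, some `k + 1` of them would force rank at least `k + 1`.
  have hcard : s.card ≤ k + 1 := by
    by_contra h
    obtain ⟨t, hts, ht⟩ := Finset.exists_subset_card_eq (show k + 1 ≤ s.card by omega)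
    have := hle t hts ht.le
    omega
  have h1 := LinearMap.finrank_range_add_finrank_ker (evalOn k s)
  rw [finrank_range_evalOn s hcard, ← hker] at h1
  omega

/-- Every monomial of degree at most `2 * k` is a combination of products of two factors of degree
at most `k`. This identifies `σ` with the form witnessing membership in `hankelSet`. -/
theorem hankel_injective (n k : ℕ) :
    Function.Injective (hankel : Module.Dual ℝ (PolyLE n (2 * k)) → _) := by
  intro σ τ h
  obtain ⟨σ₁, hσ₁⟩ := LinearMap.exists_extend σ
  obtain ⟨τ₁, hτ₁⟩ := LinearMap.exists_extend τ
  suffices hle : PolyLE n (2 * k) ≤ LinearMap.eqLocus σ₁ τ₁ by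
    rw [← hσ₁, ← hτ₁]
    exact LinearMap.ext fun f => hle f.2
  refine polyLE_le fun α hα => ?_
  refine isHomogeneous_add_mem (min α.degree k) (b := α.degree - min α.degree k)
    (fun p q hp hq => ?_) (isHomogeneous_monomial 1 (by omega))
  have hp' : p ∈ PolyLE n k :=
    (mem_restrictTotalDegree _ _ _).2 (hp.totalDegree_le.trans (min_le_right _ _))
  have hq' : q ∈ PolyLE n k :=
    (mem_restrictTotalDegree _ _ _).2 (hq.totalDegree_le.trans (by omega))
  have h1 := LinearMap.congr_fun (LinearMap.congr_fun h ⟨p, hp'⟩) ⟨q, hq'⟩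
  rw [hankel_apply, hankel_apply, ← hσ₁, ← hτ₁] at h1
  exact h1

/-! ### The trace objective -/

theorem quadPoly_mem {n k : ℕ} (P : Matrix (Expo n k) (Expo n k) ℝ) :
    quadPoly P ∈ PolyLE n (2 * k) := by
  refine Submodule.sum_mem _ fun α _ => Submodule.sum_mem _ fun β _ => ?_
  rw [C_mul']
  exact Submodule.smul_mem _ _ (mul_mem (mono α) (mono β))

/-- By cyclicity of the trace, the objective is linear in `σ`: one can read off what each atom
contributes. -/
theorem objective_hankel {n k : ℕ} (P : Matrix (Expo n k) (Expo n k) ℝ)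
    (σ : Module.Dual ℝ (PolyLE n (2 * k))) :
    objective P (hankel σ) = σ ⟨quadPoly P, quadPoly_mem P⟩ := by
  have h1 : (⟨quadPoly P, quadPoly_mem P⟩ : PolyLE n (2 * k)) =
      ∑ α : Expo n k, ∑ β : Expo n k, (P * P.transpose) α β •
        ⟨(mono α : MvPolynomial (Fin n) ℝ) * (mono β : MvPolynomial (Fin n) ℝ),
          mul_mem (mono α) (mono β)⟩ := by
    ext1
    simp only [quadPoly, mono, C_mul', Submodule.coe_sum, Submodule.coe_smul]
  rw [h1, objective, Matrix.trace_mul_cycle]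
  simp only [map_sum, map_smul, smul_eq_mul, Matrix.trace, Matrix.diag, Matrix.mul_apply (M := P * _)]
  refine Finset.sum_congr rfl fun α _ => Finset.sum_congr rfl fun β _ => ?_
  congr 1
  rw [toMat, Matrix.of_apply, hankel_apply]
  congr 2
  exact mul_comm _ _

/-- `q` is a sum of squares, one per column of `P`, and its top component is the sum of the squares
of their degree `k` parts. With properness this gives strict positivity off the origin. -/
theorem eval_homogeneousComponent_quadPoly_nonneg {n k : ℕ} (P : Matrix (Expo n k) (Expo n k) ℝ)
    (x : Fin n → ℝ) : 0 ≤ eval x (homogeneousComponent (2 * k) (quadPoly P)) := by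
  have h : eval x (homogeneousComponent (2 * k) (quadPoly P)) =
      ∑ l, (∑ α : Expo n k, P α l * eval x (homogeneousComponent k (monomial α.1 (1 : ℝ)))) ^ 2 := by
    have h1 : ∀ α β : Expo n k, homogeneousComponent (2 * k)
        (monomial α.1 (1 : ℝ) * monomial β.1 1) =
        homogeneousComponent k (monomial α.1 (1 : ℝ)) *
          homogeneousComponent k (monomial β.1 (1 : ℝ)) := by
      intro α β
      have hα := α.2
      have hβ := β.2
      rw [monomial_mul, one_mul, homogeneousComponent_monomial_one,
        homogeneousComponent_monomial_one, homogeneousComponent_monomial_one, map_add]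
      by_cases h2 : α.1.degree = k
      · by_cases h3 : β.1.degree = k
        · rw [if_pos (by omega), if_pos h2, if_pos h3, monomial_mul, one_mul]
        · rw [if_neg (by omega), if_neg h3, mul_zero]
      · rw [if_neg (by omega), if_neg h2, zero_mul]
    simp only [quadPoly, map_sum, homogeneousComponent_C_mul, h1, eval_mul, eval_C]
    simp only [sq, Finset.sum_mul_sum, Matrix.mul_apply, Matrix.transpose_apply]
    symm
    rw [Finset.sum_comm]
    refine Finset.sum_congr rfl fun α _ => ?_
    rw [Finset.sum_comm]
    refine Finset.sum_congr rfl fun β _ => ?_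
    rw [Finset.sum_mul]
    refine Finset.sum_congr rfl fun l _ => ?_
    ring
  rw [h]
  exact Finset.sum_nonneg fun l _ => sq_nonneg _

end HankelCubature

end

/-! ### The minimizer has no atoms at infinity -/

theorem mainTheorem2 (n k r : ℕ) (A : Finset (Fin n →₀ ℕ))
    (i : Module.Dual ℝ (HankelCubature.monSpan A))
    (P : Matrix (HankelCubature.Expo n k) (HankelCubature.Expo n k) ℝ)
    (hP : HankelCubature.IsProper P)
    (hk : ((HankelCubature.degV A : ℝ) + 1) / 2 ≤ (k : ℝ))
    (σ : Module.Dual ℝ (HankelCubature.PolyLE n (2 * k)))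
    (hmin : HankelCubature.IsMinimizer i P (HankelCubature.hankel σ))
    (hrank : Module.finrank ℝ (LinearMap.range (HankelCubature.hankel σ)) = r)
    (hr : r ≤ k) :
    HankelCubature.hankel σ ∈ HankelCubature.cubatureSet i k r ∧
    ∃ (ω : Fin r → ℝ) (ζ : Fin r → Fin n → ℝ),
      (∀ j, 0 < ω j) ∧ Function.Injective ζ ∧
      σ = ∑ j, ω j • HankelCubature.evalAt (2 * k) (ζ j) ∧
      ∀ v : HankelCubature.monSpan A,
        i v = ∑ j, ω j * MvPolynomial.eval (ζ j) (v : MvPolynomial (Fin n) ℝ) := by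
  open HankelCubature in
  open MvPolynomial in
  have hdeg : degV A + 1 ≤ 2 * k := by
    have : ((degV A + 1 : ℕ) : ℝ) ≤ (2 * k : ℕ) := by push_cast; linarith
    exact_mod_cast this
  -- Even for empty `A` the bound forces `k ≥ 1`.
  obtain ⟨K, rfl⟩ : ∃ K, k = K + 1 := ⟨k - 1, by omega⟩
  obtain ⟨⟨σ', hσ', hext', hpsd'⟩, hopt⟩ := hmin
  have hinj : σ = σ' := hankel_injective n (K + 1) hσ'
  subst hinj
  obtain ⟨κ, _, u, ζ, κ', _, u', η, hu, hu', hη, hσ⟩ :=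
    exists_atomic_at_infinity σ hpsd' (hrank.le.trans hr)
  obtain ⟨s, w, hw, hsum⟩ := exists_finset_weights u hu ζ
  -- The finite part of `σ`: a competitor with the same moments, since `deg V < 2k`.
  let μ : Module.Dual ℝ (PolyLE n (2 * (K + 1))) := ∑ z ∈ s, w z • evalAt (2 * (K + 1)) z
  have hμ : ∀ f : PolyLE n (2 * (K + 1)),
      μ f = ∑ z ∈ s, w z * eval z (f : MvPolynomial (Fin n) ℝ) := fun f => by
    simp [μ, LinearMap.sum_apply, evalAt_apply]
  have hσμ : ∀ f : PolyLE n (2 * (K + 1)), σ f = μ f + ∑ c, u' c * eval (η c)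
      (homogeneousComponent (2 * (K + 1)) (f : MvPolynomial (Fin n) ℝ)) := fun f => by
    rw [hσ, hμ, hsum fun z => eval z (f : MvPolynomial (Fin n) ℝ)]
  have hμmem : hankel μ ∈ hankelSet i (K + 1) := by
    refine ⟨μ, rfl, fun α hA hd => ?_, fun p => ?_⟩
    · rw [← hext' α hA hd, hσμ]
      have hα : α.degree ≠ 2 * (K + 1) := by
        have : α.degree ≤ degV A := Finset.le_sup (f := fun α : Fin n →₀ ℕ => α.degree) hA
        omega
      simp [homogeneousComponent_monomial_one, hα]
    · rw [hankel_apply, hμ]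
      refine Finset.sum_nonneg fun z hz => mul_nonneg (hw z hz).le ?_
      rw [map_mul]
      exact mul_self_nonneg _
  have hle := hopt _ hμmem
  rw [objective_hankel, objective_hankel, hσμ] at hle
  have hpos : ∀ c, 0 < eval (η c) (homogeneousComponent (2 * (K + 1)) (quadPoly P)) := fun c =>
    lt_of_le_of_ne (eval_homogeneousComponent_quadPoly_nonneg P _) (hP _ (hη c)).symm
  -- The objective of `σ` exceeds that of `μ` by this sum of nonnegative terms, so minimality makes
  -- each term vanish.
  have hzero : ∀ c, u' c = 0 := by
    have hnn : ∀ c ∈ Finset.univ,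
        0 ≤ u' c * eval (η c) (homogeneousComponent (2 * (K + 1)) (quadPoly P)) :=
      fun c _ => mul_nonneg (hu' c) (hpos c).le
    have h0 := le_antisymm (by linarith) (Finset.sum_nonneg hnn)
    intro c
    have := (Finset.sum_eq_zero_iff_of_nonneg hnn).1 h0 c (Finset.mem_univ c)
    exact (mul_eq_zero.1 this).resolve_right (hpos c).ne'
  have hσeq : σ = μ := by
    ext f
    rw [hσμ]
    simp [hzero]
  have hcard : s.card = r := by
    rw [← hrank]
    exact card_eq_finrank_range_hankel σ s w hw (fun f => by rw [hσeq, hμ]) (hrank.le.trans hr)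
  let e : Fin r ≃ s := (s.equivFinOfCardEq hcard).symm
  have hsumFin : ∀ {M : Type} [AddCommMonoid M] (g : (Fin n → ℝ) → M),
      ∑ z ∈ s, g z = ∑ j, g (e j) := fun g => by
    rw [← Finset.sum_coe_sort s g]
    exact (e.sum_comp fun z : s => g z).symm
  have hσfin : σ = ∑ j, w (e j) • evalAt (2 * (K + 1)) (e j : Fin n → ℝ) := by
    rw [hσeq]
    exact hsumFin fun z => w z • evalAt (2 * (K + 1)) z
  refine ⟨⟨⟨σ, rfl, hext', hpsd'⟩, fun j => w (e j), fun j => e j, fun j => hw _ (e j).2,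
      congrArg hankel hσfin⟩, fun j => w (e j), fun j => e j, fun j => hw _ (e j).2,
    fun a b h => e.injective (Subtype.ext h), hσfin, ?_⟩
  let R : Module.Dual ℝ (MvPolynomial (Fin n) ℝ) :=
    ∑ j, w (e j) • (aeval (e j : Fin n → ℝ) : MvPolynomial (Fin n) ℝ →ₐ[ℝ] ℝ).toLinearMap
  have hR : ∀ f, R f = ∑ j, w (e j) * eval (e j : Fin n → ℝ) f := fun f => by
    simp [R, LinearMap.sum_apply, aeval_eq_eval]
  rintro ⟨v, hv⟩
  rw [← hR]
  induction hv using Submodule.span_induction with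
  | mem x hx =>
    obtain ⟨α, hα, rfl⟩ := hx
    have hd : α.degree ≤ 2 * (K + 1) := by
      have : α.degree ≤ degV A := Finset.le_sup (f := fun α : Fin n →₀ ℕ => α.degree) hα
      omega
    have h1 := hext' α hα hd
    rw [hσfin] at h1
    simp only [LinearMap.sum_apply, LinearMap.smul_apply, evalAt_apply, smul_eq_mul] at h1
    rw [hR]
    exact h1.symm
  | zero =>
    rw [map_zero]
    exact i.map_zero
  | add x y hx hy h1 h2 =>
    rw [map_add, ← h1, ← h2, ← map_add]
    rfl
  | smul c x hx h1 =>
    rw [map_smul, ← h1, ← map_smul]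
    rfl
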